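/- Let $\Omega\subset\mathbb R^n$ be a bounded open set, and let $H^1_0(\Omega)$ be the closure of $C_c^\infty(\Omega)$ in $H^1(\Omega)$, with the norm $\|u\|^2=\|u\|_{L^2(\Omega)}^2+\|\nabla u\|_{L^2(\Omega)}^2$. Let $a_{ij},a_i,a_0\in L^\infty(\Omega)$ ($1\le i,j\le n$) and $$a(u,v)=\sum_{i,j=1}^n\int_\Omega a_{ij}\,\frac{\partial u}{\partial x_i}\frac{\partial v}{\partial x_j}\,dx+\sum_{i=1}^n\int_\Omega a_i\,\frac{\partial u}{\partial x_i}\,v\,dx+\int_\Omega a_0\,u\,v\,dx ,\qquad u,v\in H^1_0(\Omega).$$ Assume that $a$ is coercive: there is $m>0$ with $a(u,u)\ge m\|u\|^2$ for all $u\in H^1_0(\Omega)$. Let $f\in L^2(\Omega)$. For $\delta>0$ put $$\beta_\delta(r)=\frac1\delta\begin{cases}0,& r\ge 0,\\ -r^2,& -\tfrac12\le r\le 0,\\ r+\tfrac14,& r\le-\tfrac12.\end{cases}$$ For $\delta>0$ and $\psi\in H^1_0(\Omega)$, let $\mathcal T^\delta(\psi)$ be the weak solution $y\in H^1_0(\Omega)$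 of the penalized equation $Ay+\beta_\delta(y-\psi)=f$ (where $\langle Au,v\rangle=a(u,v)$), that is, $$a(y,v)+\int_\Omega\beta_\delta(y-\psi)\,v\,dx=\int_\Omega f\,v\,dx\qquad\text{for all } v\in H^1_0(\Omega).$$ For $\psi\in H^1_0(\Omega)$ let $\mathcal K(\psi)=\{v\in H^1_0(\Omega): v\ge\psi\text{ a.e. in }\Omega\}$, and let $\mathcal T(\psi)$ be the solution $y\in\mathcal K(\psi)$ of the obstacle variational inequality $$a(y,v-y)\ge\int_\Omega f\,(v-y)\,dx\qquad\text{for all } v\in\mathcal K(\psi).$$ Then both problems have exactly one solution for all $\delta>0$ and $\psi\in H^1_0(\Omega)$, so that $\mathcal T^\delta$ and $\mathcal T$ are well defined on $H^1_0(\Omega)$. Moreover, if $\varphi^\delta\in H^1_0(\Omega)$ for $\delta>0$, $\varphi\in H^1_0(\Omega)$ and $\varphi^\delta\to\varphi$ strongly in $H^1_0(\Omega)$ as $\delta\to0^+$, then $$\mathcal T^\delta(\varphi^\delta)\to\mathcal T(\varphi)\quad\text{strongly in } H^1_0(\Omega)\text{ as }\delta\to0^+ .$$ -/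

import Mathlib

open MeasureTheory Filter Topology
open scoped ENNReal ContDiff

noncomputable section

namespace ObstacleProblem

variable {n : ℕ}

/-- Lebesgue measure on the set `Ω ⊆ ℝⁿ`. -/
abbrev vol (Ω : Set (EuclideanSpace ℝ (Fin n))) : Measure (EuclideanSpace ℝ (Fin n)) :=
  volume.restrict Ω

/-- The Hilbert space `L²(Ω) × L²(Ω; ℝⁿ)` with `‖(u, g)‖² = ‖u‖² + ‖g‖²`. A function of
`H¹(Ω)` is represented by the pair `(u, ∇u)` of the function and its weak gradient, so that the
norm of the pair is the usual `H¹` norm of `u`. -/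
abbrev Pairs (Ω : Set (EuclideanSpace ℝ (Fin n))) : Type :=
  WithLp 2 (Lp ℝ 2 (vol Ω) × Lp (EuclideanSpace ℝ (Fin n)) 2 (vol Ω))

/-- Test functions: smooth functions with compact support contained in `Ω`. -/
structure IsTestFunction (Ω : Set (EuclideanSpace ℝ (Fin n)))
    (η : EuclideanSpace ℝ (Fin n) → ℝ) : Prop where
  smooth : ContDiff ℝ ∞ η
  compact : HasCompactSupport η
  support_subset : tsupport η ⊆ Ω

/-- The `i`-th classical partial derivative. -/
def partialDeriv (i : Fin n) (η : EuclideanSpace ℝ (Fin n) → ℝ)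
    (x : EuclideanSpace ℝ (Fin n)) : ℝ :=
  fderiv ℝ η x (EuclideanSpace.single i 1)

/-- `g` is the weak gradient of `u` in `Ω`. -/
def IsWeakGradient (Ω : Set (EuclideanSpace ℝ (Fin n)))
    (u : EuclideanSpace ℝ (Fin n) → ℝ)
    (g : EuclideanSpace ℝ (Fin n) → EuclideanSpace ℝ (Fin n)) : Prop :=
  ∀ η, IsTestFunction Ω η → ∀ i : Fin n,
    ∫ x in Ω, u x * partialDeriv i η x = -∫ x in Ω, g x i * η x

theorem IsTestFunction.add {Ω : Set (EuclideanSpace ℝ (Fin n))}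
    {η ζ : EuclideanSpace ℝ (Fin n) → ℝ} (h : IsTestFunction Ω η) (k : IsTestFunction Ω ζ) :
    IsTestFunction Ω (η + ζ) :=
  ⟨h.smooth.add k.smooth, h.compact.add k.compact,
    (tsupport_add η ζ).trans (Set.union_subset h.support_subset k.support_subset)⟩

theorem IsTestFunction.smul {Ω : Set (EuclideanSpace ℝ (Fin n))}
    {η : EuclideanSpace ℝ (Fin n) → ℝ} (c : ℝ) (h : IsTestFunction Ω η) :
    IsTestFunction Ω (c • η) :=
  ⟨h.smooth.const_smul c, h.compact.mono (Function.support_const_smul_subset c η),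
    (closure_mono (Function.support_const_smul_subset c η)).trans h.support_subset⟩

theorem IsTestFunction.zero (Ω : Set (EuclideanSpace ℝ (Fin n))) :
    IsTestFunction Ω (0 : EuclideanSpace ℝ (Fin n) → ℝ) :=
  ⟨contDiff_const, HasCompactSupport.zero, by simp [tsupport]⟩

theorem IsTestFunction.memLp {Ω : Set (EuclideanSpace ℝ (Fin n))}
    {η : EuclideanSpace ℝ (Fin n) → ℝ} (h : IsTestFunction Ω η) : MemLp η 2 (vol Ω) :=
  (h.smooth.continuous.memLp_of_hasCompactSupport h.compact).restrict Ω

theorem IsTestFunction.memLp_partialDeriv {Ω : Set (EuclideanSpace ℝ (Fin n))}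
    {η : EuclideanSpace ℝ (Fin n) → ℝ} (h : IsTestFunction Ω η) (i : Fin n) :
    MemLp (partialDeriv i η) 2 (vol Ω) := by
  have hc : Continuous (partialDeriv i η) :=
    (h.smooth.continuous_fderiv (by simp)).clm_apply continuous_const
  have hs : HasCompactSupport (partialDeriv i η) := h.compact.fderiv_apply (𝕜 := ℝ) _
  exact (hc.memLp_of_hasCompactSupport hs).restrict Ω

theorem memLp_coord {Ω : Set (EuclideanSpace ℝ (Fin n))}
    (g : Lp (EuclideanSpace ℝ (Fin n)) 2 (vol Ω)) (i : Fin n) :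
    MemLp (fun x => g x i) 2 (vol Ω) :=
  (EuclideanSpace.proj (𝕜 := ℝ) i).comp_memLp' (Lp.memLp g)

/-- The Sobolev space `H¹(Ω)`. -/
def H1 (Ω : Set (EuclideanSpace ℝ (Fin n))) : Submodule ℝ (Pairs Ω) where
  carrier := {p | IsWeakGradient Ω p.fst p.snd}
  zero_mem' := by
    intro η hη i
    have h1 := Lp.coeFn_zero ℝ 2 (vol Ω)
    have h2 := Lp.coeFn_zero (EuclideanSpace ℝ (Fin n)) 2 (vol Ω)
    rw [integral_eq_zero_of_ae, integral_eq_zero_of_ae, neg_zero]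
    · filter_upwards [h2] with x hx
      have hx' : (0 : Pairs Ω).snd x = 0 := hx
      rw [hx']
      simp
    · filter_upwards [h1] with x hx
      have hx' : (0 : Pairs Ω).fst x = 0 := hx
      rw [hx']
      simp
  add_mem' := by
    intro p q hp hq η hη i
    have h1 : ∫ x in Ω, (p + q).fst x * partialDeriv i η x =
        ∫ x in Ω, (p.fst x * partialDeriv i η x + q.fst x * partialDeriv i η x) := by
      apply integral_congr_ae
      filter_upwards [Lp.coeFn_add p.fst q.fst] with x hx
      have hx' : (p + q).fst x = p.fst x + q.fst x := hx
      rw [hx']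
      simp [add_mul]
    have h2 : ∫ x in Ω, (p + q).snd x i * η x =
        ∫ x in Ω, (p.snd x i * η x + q.snd x i * η x) := by
      apply integral_congr_ae
      filter_upwards [Lp.coeFn_add p.snd q.snd] with x hx
      have hx' : (p + q).snd x = p.snd x + q.snd x := hx
      rw [hx']
      simp [add_mul]
    rw [h1, h2, integral_add, integral_add, hp η hη i, hq η hη i]
    · ring
    · exact (memLp_coord p.snd i).integrable_mul hη.memLp
    · exact (memLp_coord q.snd i).integrable_mul hη.memLp
    · exact (Lp.memLp p.fst).integrable_mul (hη.memLp_partialDeriv i)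
    · exact (Lp.memLp q.fst).integrable_mul (hη.memLp_partialDeriv i)
  smul_mem' := by
    intro c p hp η hη i
    have h1 : ∫ x in Ω, (c • p).fst x * partialDeriv i η x =
        ∫ x in Ω, c * (p.fst x * partialDeriv i η x) := by
      apply integral_congr_ae
      filter_upwards [Lp.coeFn_smul c p.fst] with x hx
      have hx' : (c • p).fst x = c • p.fst x := hx
      rw [hx']
      simp [mul_assoc]
    have h2 : ∫ x in Ω, (c • p).snd x i * η x = ∫ x in Ω, c * (p.snd x i * η x) := by
      apply integral_congr_ae
      filter_upwards [Lp.coeFn_smul c p.snd] with x hx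
      have hx' : (c • p).snd x = c • p.snd x := hx
      rw [hx']
      simp [mul_assoc]
    rw [h1, h2, integral_const_mul, integral_const_mul, hp η hη i]
    ring

/-- The test functions, as a subspace of `H¹(Ω)`. -/
def testSubspace (Ω : Set (EuclideanSpace ℝ (Fin n))) : Submodule ℝ (Pairs Ω) where
  carrier := {p | p ∈ H1 Ω ∧ ∃ η, IsTestFunction Ω η ∧ p.fst =ᵐ[vol Ω] η}
  zero_mem' := ⟨(H1 Ω).zero_mem, 0, IsTestFunction.zero Ω, Lp.coeFn_zero ℝ 2 (vol Ω)⟩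
  add_mem' := by
    rintro p q ⟨hp, η, hη, hpη⟩ ⟨hq, ζ, hζ, hqζ⟩
    exact ⟨(H1 Ω).add_mem hp hq, η + ζ, hη.add hζ,
      (Lp.coeFn_add p.fst q.fst).trans (hpη.add hqζ)⟩
  smul_mem' := by
    rintro c p ⟨hp, η, hη, hpη⟩
    exact ⟨(H1 Ω).smul_mem c hp, c • η, hη.smul c,
      (Lp.coeFn_smul c p.fst).trans (hpη.const_smul c)⟩

/-- The Sobolev space `H¹₀(Ω)`, the closure of the test functions for the `H¹` norm, with
that norm. (`H¹(Ω)` is closed in `Pairs Ω`, so this is the closure in `H¹(Ω)`.) -/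
def H10 (Ω : Set (EuclideanSpace ℝ (Fin n))) : Submodule ℝ (Pairs Ω) :=
  (testSubspace Ω).topologicalClosure

/-- The function `u ∈ L²(Ω)` underlying an element of `H¹₀(Ω)`. -/
abbrev val {Ω : Set (EuclideanSpace ℝ (Fin n))} (u : H10 Ω) : Lp ℝ 2 (vol Ω) :=
  (u : Pairs Ω).fst

/-- The weak gradient `∇u ∈ L²(Ω; ℝⁿ)` of an element of `H¹₀(Ω)`. -/
abbrev grad {Ω : Set (EuclideanSpace ℝ (Fin n))} (u : H10 Ω) :
    Lp (EuclideanSpace ℝ (Fin n)) 2 (vol Ω) :=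
  (u : Pairs Ω).snd

/-- The coefficients `a_{ij}`, `a_i`, `a₀` of the operator, all in `L^∞(Ω)`. -/
structure Coefficients (Ω : Set (EuclideanSpace ℝ (Fin n))) where
  /-- `a_{ij}` -/
  second : Fin n → Fin n → EuclideanSpace ℝ (Fin n) → ℝ
  /-- `a_i` -/
  first : Fin n → EuclideanSpace ℝ (Fin n) → ℝ
  /-- `a₀` -/
  zeroth : EuclideanSpace ℝ (Fin n) → ℝ
  second_memLp : ∀ i j, MemLp (second i j) ∞ (vol Ω)
  first_memLp : ∀ i, MemLp (first i) ∞ (vol Ω)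
  zeroth_memLp : MemLp zeroth ∞ (vol Ω)

/-- The bilinear form `a(u, v) = ⟨A u, v⟩`. -/
def bilin {Ω : Set (EuclideanSpace ℝ (Fin n))} (A : Coefficients Ω) (u v : H10 Ω) : ℝ :=
  (∑ i, ∑ j, ∫ x in Ω, A.second i j x * grad u x i * grad v x j) +
    (∑ i, ∫ x in Ω, A.first i x * grad u x i * val v x) +
    ∫ x in Ω, A.zeroth x * val u x * val v x

/-- `a` is coercive on `H¹₀(Ω)`. -/
def IsCoerciveForm {Ω : Set (EuclideanSpace ℝ (Fin n))} (A : Coefficients Ω) : Prop :=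
  ∃ m : ℝ, 0 < m ∧ ∀ u : H10 Ω, m * ‖u‖ ^ 2 ≤ bilin A u u

/-- The penalty function `β_δ`. -/
def penalty (δ r : ℝ) : ℝ :=
  (1 / δ) * (if 0 ≤ r then 0 else if -(1 / 2) ≤ r then -r ^ 2 else r + 1 / 4)

/-- `y ∈ H¹₀(Ω)` is a weak solution of `A y + β_δ(y - φ) = f` in `Ω`, `y = 0` on `∂Ω`. -/
def IsPenalizedSolution {Ω : Set (EuclideanSpace ℝ (Fin n))} (A : Coefficients Ω)
    (f : Lp ℝ 2 (vol Ω)) (δ : ℝ) (φ y : H10 Ω) : Prop :=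
  ∀ v : H10 Ω, bilin A y v + ∫ x in Ω, penalty δ (val y x - val φ x) * val v x =
    ∫ x in Ω, f x * val v x

/-- The admissible set `K(φ) = {y ∈ H¹₀(Ω) : y ≥ φ a.e. in Ω}`. -/
def admissible {Ω : Set (EuclideanSpace ℝ (Fin n))} (φ : H10 Ω) : Set (H10 Ω) :=
  {y | ∀ᵐ x ∂(vol Ω), val φ x ≤ val y x}

/-- `y` solves the obstacle problem: `y ∈ K(φ)` and `a(y, v - y) ≥ (f, v - y)` for all
`v ∈ K(φ)`. -/
def IsObstacleSolution {Ω : Set (EuclideanSpace ℝ (Fin n))} (A : Coefficients Ω)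
    (f : Lp ℝ 2 (vol Ω)) (φ y : H10 Ω) : Prop :=
  y ∈ admissible φ ∧
    ∀ v ∈ admissible φ, ∫ x in Ω, f x * val (v - y) x ≤ bilin A y (v - y)

/-- `𝒯^δ(φ)`: the solution of the penalized equation. -/
def penalizedState {Ω : Set (EuclideanSpace ℝ (Fin n))} (A : Coefficients Ω)
    (f : Lp ℝ 2 (vol Ω)) (δ : ℝ) (φ : H10 Ω) : H10 Ω :=
  Classical.epsilon fun y => IsPenalizedSolution A f δ φ y

/-- `𝒯(φ)`: the solution of the obstacle problem. -/
def obstacleState {Ω : Set (EuclideanSpace ℝ (Fin n))} (A : Coefficients Ω)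
    (f : Lp ℝ 2 (vol Ω)) (φ : H10 Ω) : H10 Ω :=
  Classical.epsilon fun y => IsObstacleSolution A f φ y

end ObstacleProblem

end

/-! Everything takes place in a Hilbert space `V` with a bounded coercive bilinear form `B` and a
bounded linear map `J` into `L²`; no compactness of `J` is needed.

Well-posedness: the penalty is monotone and Lipschitz, so the penalized operator is Lipschitz and
strongly monotone. Both problems are then variational inequalities for such an operator, on the
whole space and on the closed convex set `K(ψ)` respectively, and
`existsUnique_variationalInequality` solves them by a projected contraction.

Convergence: testing with `y - φ` bounds `y^δ` and the penalty energy uniformly in `δ`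
(`penalty_energy_bound`). Along any ultrafilter finer than `δ → 0⁺`, `y^δ` thus has a weak limit
`z`, and the energy bound forces the negative part of `y^δ - φ^δ` to vanish in `L²`, so `z ≥ φ`.
Testing with `y + (φ^δ - φ) - y^δ`, where `y = 𝒯(φ)`, gives the penalty term a sign, and coercivity
yields `m‖y^δ - y‖² ≤ (f, y^δ - y) - a(y, y^δ - y) + D‖φ^δ - φ‖`. The right side is affine in `y^δ`
up to a vanishing term, so it tends to `(f, z - y) - a(y, z - y)`, which is `≤ 0` by the obstacle
inequality at `z`. Strong convergence follows without first identifying `z` with `y`. -/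

open scoped NNReal

/-! ### Hilbert space tools: variational inequalities and weak limits. -/

/-- **Strongly monotone variational inequalities**: a Lipschitz, strongly monotone operator `G` on
a real Hilbert space and a nonempty closed convex set `K` admit a unique `u ∈ K` with
`⟪G u, v - u⟫ ≥ 0` for all `v ∈ K`. -/
theorem existsUnique_variationalInequality {V : Type*} [NormedAddCommGroup V]
    [InnerProductSpace ℝ V] [CompleteSpace V] {G : V → V} {L : ℝ≥0} {m : ℝ} (hm : 0 < m)
    (hL : LipschitzWith L G) (hG : ∀ u v, m * ‖u - v‖ ^ 2 ≤ inner ℝ (G u - G v) (u - v))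
    {K : Set V} (hne : K.Nonempty) (hcl : IsClosed K) (hK : Convex ℝ K) :
    ∃! u, u ∈ K ∧ ∀ v ∈ K, 0 ≤ inner ℝ (G u) (v - u) := by
  have hproj : ∀ u : V, ∃ p ∈ K, ∀ w ∈ K, inner ℝ (u - p) (w - p) ≤ 0 := fun u => by
    obtain ⟨p, hp, h⟩ := exists_norm_eq_iInf_of_complete_convex hne hcl.isComplete hK u
    exact ⟨p, hp, (norm_eq_iInf_iff_real_inner_le_zero hK hp).1 h⟩
  choose P hPK hP using hproj
  have hPnonexp : ∀ u v, ‖P u - P v‖ ≤ ‖u - v‖ := fun u v => by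
    have h1 := hP u (P v) (hPK v)
    have h2 := hP v (P u) (hPK u)
    -- Sum of the two obtuse-angle inequalities; Cauchy–Schwarz then gives nonexpansiveness.
    have h3 : ‖P u - P v‖ ^ 2 ≤ inner ℝ (u - v) (P u - P v) := by
      rw [← real_inner_self_eq_norm_sq]
      simp only [inner_sub_left, inner_sub_right] at h1 h2 ⊢
      linarith
    have h4 := real_inner_le_norm (u - v) (P u - P v)
    by_contra! hlt
    have : 0 ≤ ‖u - v‖ := norm_nonneg _
    nlinarith
  -- The maximum with `m` ensures `M > 0` and `q ≥ 0`.
  set M : ℝ := max L m with hMdef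
  have hM : 0 < M := hm.trans_le (le_max_right _ _)
  have hGM : ∀ u v, ‖G u - G v‖ ≤ M * ‖u - v‖ := fun u v =>
    (hL.norm_sub_le u v).trans (mul_le_mul_of_nonneg_right (le_max_left _ _) (norm_nonneg _))
  -- This step size minimises `1 - 2ρm + ρ²M²`, the bound for the squared Lipschitz constant of `u ↦
  -- u - ρ G u`; the minimum is `q`.
  set ρ : ℝ := m / M ^ 2 with hρdef
  have hρ : 0 < ρ := by positivity
  set q : ℝ := 1 - m ^ 2 / M ^ 2 with hqdef
  have hq1 : q < 1 := by
    have : 0 < m ^ 2 / M ^ 2 := by positivity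
    linarith
  have hq0 : 0 ≤ q := by
    have : m ^ 2 / M ^ 2 ≤ 1 := by
      rw [div_le_one (by positivity)]
      exact pow_le_pow_left₀ hm.le (le_max_right _ _) 2
    linarith
  have hstep : ∀ u v, ‖(u - ρ • G u) - (v - ρ • G v)‖ ≤ √q * ‖u - v‖ := fun u v => by
    have hsq : ‖(u - ρ • G u) - (v - ρ • G v)‖ ^ 2 ≤ q * ‖u - v‖ ^ 2 := by
      have e : (u - ρ • G u) - (v - ρ • G v) = (u - v) - ρ • (G u - G v) := by
        rw [smul_sub]; abel
      rw [e, norm_sub_sq_real, inner_smul_right, norm_smul, mul_pow, Real.norm_eq_abs, sq_abs,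
        real_inner_comm]
      have h1 := hG u v
      have h2 : ‖G u - G v‖ ^ 2 ≤ M ^ 2 * ‖u - v‖ ^ 2 := by
        rw [← mul_pow]; exact pow_le_pow_left₀ (norm_nonneg _) (hGM u v) 2
      have h3 : ρ * (m * ‖u - v‖ ^ 2) ≤ ρ * inner ℝ (G u - G v) (u - v) := by gcongr
      have h4 : ρ ^ 2 * ‖G u - G v‖ ^ 2 ≤ ρ ^ 2 * (M ^ 2 * ‖u - v‖ ^ 2) := by gcongr
      have h5 : ρ ^ 2 * (M ^ 2 * ‖u - v‖ ^ 2) = m ^ 2 / M ^ 2 * ‖u - v‖ ^ 2 := by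
        rw [hρdef]; field_simp
      have h6 : ρ * (m * ‖u - v‖ ^ 2) = m ^ 2 / M ^ 2 * ‖u - v‖ ^ 2 := by
        rw [hρdef]; field_simp
      rw [hqdef, sub_mul, one_mul]
      linarith
    refine le_of_sq_le_sq ?_ (by positivity)
    rwa [mul_pow, Real.sq_sqrt hq0]
  have hcontr : ContractingWith (Real.toNNReal √q) fun u => P (u - ρ • G u) := by
    refine ⟨?_, LipschitzWith.of_dist_le_mul fun u v => ?_⟩
    · exact Real.toNNReal_lt_one.2 ((Real.sqrt_lt' one_pos).2 (by simpa using hq1))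
    · rw [dist_eq_norm, dist_eq_norm, Real.coe_toNNReal _ (Real.sqrt_nonneg q)]
      exact (hPnonexp _ _).trans (hstep u v)
  have : Nonempty V := ⟨hne.some⟩
  have hfix : P (_ - ρ • G _) = _ := hcontr.fixedPoint_isFixedPt
  set u := hcontr.fixedPoint
  refine ⟨u, ⟨hfix ▸ hPK _, fun v hv => ?_⟩, fun w hw => ?_⟩
  · have h := hP (u - ρ • G u) v hv
    rw [hfix, sub_sub_cancel_left, inner_neg_left, inner_smul_left] at h
    simp only [conj_trivial] at h
    have h' : 0 ≤ ρ * inner ℝ (G u) (v - u) := by linarith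
    exact (mul_nonneg_iff_of_pos_left hρ).1 h'
  · have huK : u ∈ K := hfix ▸ hPK _
    have h1 := hP (u - ρ • G u) w hw.1
    rw [hfix, sub_sub_cancel_left, inner_neg_left, inner_smul_left] at h1
    simp only [conj_trivial] at h1
    have h1' : 0 ≤ inner ℝ (G u) (w - u) :=
      (mul_nonneg_iff_of_pos_left hρ).1 (by linarith)
    have h2 := hw.2 u huK
    have h3 := hG w u
    have h4 : inner ℝ (G w - G u) (w - u) = -inner ℝ (G w) (u - w) - inner ℝ (G u) (w - u) := by
      rw [inner_sub_left, ← neg_sub u w, inner_neg_right, inner_neg_right]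
    have h5 : ‖w - u‖ ^ 2 ≤ 0 := by
      by_contra! h
      have := mul_pos hm h
      linarith
    have h6 : ‖w - u‖ = 0 := by
      have := sq_nonneg ‖w - u‖
      exact pow_eq_zero_iff two_ne_zero |>.1 (le_antisymm h5 this)
    exact sub_eq_zero.1 (norm_eq_zero.1 h6)

/-- A family that is bounded along an ultrafilter has a weak limit along it. -/
theorem Ultrafilter.exists_tendsto_inner {ι V : Type*} [NormedAddCommGroup V]
    [InnerProductSpace ℝ V] [CompleteSpace V] (U : Ultrafilter ι) {y : ι → V} {R : ℝ}
    (hy : ∀ᶠ i in (U : Filter ι), ‖y i‖ ≤ R) :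
    ∃ z : V, ∀ w, Tendsto (fun i => inner ℝ (y i) w) U (𝓝 (inner ℝ z w)) := by
  -- Riesz representation moves the family to the dual, where Banach–Alaoglu applies; an ultrafilter
  -- on a compact set converges.
  let F : ι → WeakDual ℝ V := fun i =>
    StrongDual.toWeakDual (InnerProductSpace.toDual ℝ V (y i))
  have hF : (U.map F : Filter (WeakDual ℝ V)) ≤
      𝓟 (WeakDual.toStrongDual ⁻¹' Metric.closedBall (0 : StrongDual ℝ V) R) := by
    rw [le_principal_iff]
    change ∀ᶠ i in (U : Filter ι), _
    filter_upwards [hy] with i hi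
    simpa [F] using hi
  obtain ⟨ξ, -, hξ⟩ := (WeakDual.isCompact_closedBall (𝕜 := ℝ)
    (0 : StrongDual ℝ V) R).ultrafilter_le_nhds (U.map F) hF
  refine ⟨(InnerProductSpace.toDual ℝ V).symm (WeakDual.toStrongDual ξ), fun w => ?_⟩
  have h : Tendsto F U (𝓝 ξ) := hξ
  have := ((WeakDual.eval_continuous w).tendsto ξ).comp h
  simpa [F, Function.comp_def] using this

noncomputable section

namespace ObstacleProblem

/-! ### The scalar penalty function. -/

theorem penalty_eq_div (δ r : ℝ) : penalty δ r = penalty 1 r / δ := by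
  simp only [penalty]; ring

theorem penalty_one_mono_lipschitz {r s : ℝ} (h : r ≤ s) :
    penalty 1 r ≤ penalty 1 s ∧ penalty 1 s - penalty 1 r ≤ s - r := by
  simp only [penalty]
  split_ifs <;> constructor <;> nlinarith

theorem penalty_one_nonpos (r : ℝ) : penalty 1 r ≤ 0 := by
  simp only [penalty]
  split_ifs <;> nlinarith

theorem penalty_nonpos {δ : ℝ} (hδ : 0 < δ) (r : ℝ) : penalty δ r ≤ 0 := by
  rw [penalty_eq_div]
  exact div_nonpos_of_nonpos_of_nonneg (penalty_one_nonpos r) hδ.le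

theorem penalty_of_nonneg (δ : ℝ) {r : ℝ} (hr : 0 ≤ r) : penalty δ r = 0 := by
  simp [penalty, hr]

theorem penalty_monotone {δ : ℝ} (hδ : 0 < δ) : Monotone (penalty δ) := fun r s h => by
  rw [penalty_eq_div δ r, penalty_eq_div δ s]
  exact div_le_div_of_nonneg_right (penalty_one_mono_lipschitz h).1 hδ.le

theorem penalty_lipschitz {δ : ℝ} (hδ : 0 < δ) :
    LipschitzWith (Real.toNNReal (1 / δ)) (penalty δ) := by
  refine LipschitzWith.of_le_add_mul _ fun r s => ?_
  rw [Real.coe_toNNReal _ (by positivity), penalty_eq_div δ r, penalty_eq_div δ s, Real.dist_eq,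
    one_div_mul_eq_div, ← add_div]
  refine div_le_div_of_nonneg_right ?_ hδ.le
  rcases le_total r s with h | h
  · linarith [(penalty_one_mono_lipschitz h).1, abs_nonneg (r - s)]
  · linarith [(penalty_one_mono_lipschitz h).2, le_abs_self (r - s)]

/-- The penalty controls the negative part of its argument. -/
theorem negPart_sq_le_penalty {ε : ℝ} (hε : 0 < ε) (hε' : ε ≤ 1 / 2) (r : ℝ) :
    max (-r) 0 ^ 2 ≤ ε ^ 2 + penalty 1 r * r / ε := by
  rcases le_or_gt 0 r with hr | hr
  · rw [max_eq_right (by linarith), penalty_of_nonneg 1 hr]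
    simp; positivity
  · rw [max_eq_left (by linarith), ← sub_le_iff_le_add', le_div_iff₀ hε]
    simp only [penalty, not_le.2 hr, if_false]
    split_ifs with h
    -- Here `penalty 1 r * r = |r|³`: either `|r| ≤ ε`, and `ε²` suffices, or `r² ≤ |r|³ / ε`.
    · rcases le_or_gt (-r) ε with h' | h'
      · have : 0 ≤ ε ^ 2 - r ^ 2 := by nlinarith
        have h3 : 0 ≤ (-r) ^ 3 := by apply pow_nonneg; linarith
        nlinarith
      · have h3 : 0 ≤ (-r - ε) * r ^ 2 := mul_nonneg (by linarith) (sq_nonneg _)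
        have : 0 < ε ^ 3 := by positivity
        nlinarith
    -- Here `penalty 1 r * r = r² - |r|/4 ≥ r²/2 ≥ ε r²`.
    · have h1 : -r ≥ 1 / 2 := by linarith
      have h2 : ε * r ^ 2 ≤ 1 / 2 * r ^ 2 := by gcongr
      have : 0 < ε ^ 3 := by positivity
      nlinarith

/-! ### The penalty and multiplication operators on `L²`. -/

section L2
variable {α : Type*} [MeasurableSpace α] {μ : Measure α}

/-- The superposition operator of the penalty on `L²`. -/
def penaltyL2 {δ : ℝ} (hδ : 0 < δ) (u : Lp ℝ 2 μ) : Lp ℝ 2 μ :=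
  (penalty_lipschitz hδ).compLp (penalty_of_nonneg δ le_rfl) u

theorem inner_L2_eq (u v : Lp ℝ 2 μ) : inner ℝ u v = ∫ x, u x * v x ∂μ := by
  rw [L2.inner_def]
  exact integral_congr_ae (.of_forall fun x => by simp [mul_comm])

theorem integrable_mul_L2 (u v : Lp ℝ 2 μ) : Integrable (fun x => u x * v x) μ :=
  (Lp.memLp u).integrable_mul (Lp.memLp v)

theorem coeFn_penaltyL2 {δ : ℝ} (hδ : 0 < δ) (u : Lp ℝ 2 μ) :
    penaltyL2 hδ u =ᵐ[μ] fun x => penalty δ (u x) :=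
  (penalty_lipschitz hδ).coeFn_compLp (penalty_of_nonneg δ le_rfl) u

theorem lipschitz_penaltyL2 {δ : ℝ} (hδ : 0 < δ) :
    LipschitzWith (Real.toNNReal (1 / δ)) (penaltyL2 hδ : Lp ℝ 2 μ → Lp ℝ 2 μ) :=
  (penalty_lipschitz hδ).lipschitzWith_compLp (penalty_of_nonneg δ le_rfl)

theorem inner_penaltyL2_sub_nonneg {δ : ℝ} (hδ : 0 < δ) (u v : Lp ℝ 2 μ) :
    0 ≤ inner ℝ (penaltyL2 hδ u - penaltyL2 hδ v) (u - v) := by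
  rw [inner_L2_eq]
  refine integral_nonneg_of_ae ?_
  filter_upwards [coeFn_penaltyL2 hδ u, coeFn_penaltyL2 hδ v, Lp.coeFn_sub u v,
    Lp.coeFn_sub (penaltyL2 hδ u) (penaltyL2 hδ v)] with x h1 h2 h3 h4
  rw [h3, h4, Pi.sub_apply, Pi.sub_apply, h1, h2]
  rcases le_total (u x) (v x) with h | h
  · exact mul_nonneg_of_nonpos_of_nonpos (sub_nonpos.2 (penalty_monotone hδ h)) (sub_nonpos.2 h)
  · exact mul_nonneg (sub_nonneg.2 (penalty_monotone hδ h)) (sub_nonneg.2 h)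

/-- If `w ≥ 0` then `⟪β(u), w - u⟫ ≤ 0`. -/
theorem inner_penaltyL2_nonpos {δ : ℝ} (hδ : 0 < δ) (u w : Lp ℝ 2 μ) (hw : ∀ᵐ x ∂μ, 0 ≤ w x) :
    inner ℝ (penaltyL2 hδ u) (w - u) ≤ 0 := by
  rw [inner_L2_eq]
  refine integral_nonpos_of_ae ?_
  filter_upwards [coeFn_penaltyL2 hδ u, Lp.coeFn_sub w u, hw] with x h1 h2 h3
  rw [h1, h2, Pi.sub_apply, Pi.zero_apply]
  rcases le_total 0 (u x) with h | h
  · simp [penalty_of_nonneg δ h]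
  · exact mul_nonpos_of_nonpos_of_nonneg (penalty_nonpos hδ _) (by linarith)

/-- The positive-part estimate: if `h ≥ 0`, then `⟪u, h⟫` is bounded below by the penalty energy. -/
theorem inner_add_penalty_nonneg [IsFiniteMeasure μ] {δ ε C : ℝ} (hδ : 0 < δ) (hε : 0 < ε)
    (hε' : ε ≤ 1 / 2) (u h : Lp ℝ 2 μ) (hh : ∀ᵐ x ∂μ, 0 ≤ h x)
    (hC : inner ℝ (penaltyL2 hδ u) u ≤ C) :
    0 ≤ inner ℝ u h + √(ε ^ 2 * μ.real Set.univ + δ * C / ε) * ‖h‖ := by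
  have hlip : LipschitzWith 1 fun r : ℝ => max (-r) 0 :=
    (LipschitzWith.id.neg).max_const 0
  let s : Lp ℝ 2 μ := hlip.compLp (by simp) u
  have hs : s =ᵐ[μ] fun x => max (-u x) 0 := hlip.coeFn_compLp _ u
  have hnorm : ‖s‖ ^ 2 ≤ ε ^ 2 * μ.real Set.univ + δ * C / ε := by
    rw [← real_inner_self_eq_norm_sq, inner_L2_eq]
    have hint := integrable_mul_L2 (penaltyL2 hδ u) u
    calc ∫ x, s x * s x ∂μ ≤ ∫ x, (ε ^ 2 + δ / ε * (penaltyL2 hδ u x * u x)) ∂μ := by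
          refine integral_mono_ae (integrable_mul_L2 s s)
            ((integrable_const _).add (hint.const_mul _)) ?_
          filter_upwards [hs, coeFn_penaltyL2 hδ u] with x h1 h2
          have := negPart_sq_le_penalty hε hε' (u x)
          rw [h1, h2, penalty_eq_div, ← sq]
          refine this.trans_eq ?_
          field_simp
      _ = ε ^ 2 * μ.real Set.univ + δ / ε * inner ℝ (penaltyL2 hδ u) u := by
          rw [integral_add (integrable_const _) (hint.const_mul _), integral_const_mul,
            integral_const, inner_L2_eq, smul_eq_mul, mul_comm (ε ^ 2)]
      _ ≤ ε ^ 2 * μ.real Set.univ + δ / ε * C := by gcongr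
      _ = _ := by ring
  -- `s` is the negative part of `u`, so `u + s` is the positive part.
  have h1 : 0 ≤ inner ℝ u h + inner ℝ s h := by
    rw [← inner_add_left, inner_L2_eq]
    refine integral_nonneg_of_ae ?_
    filter_upwards [hs, hh, Lp.coeFn_add u s] with x h1 h2 h3
    rw [h3, Pi.add_apply, h1]
    exact mul_nonneg (by linarith [le_max_left (-u x) 0]) h2
  have h2 : ‖s‖ ≤ √(ε ^ 2 * μ.real Set.univ + δ * C / ε) := Real.le_sqrt_of_sq_le hnorm
  have h3 := real_inner_le_norm s h
  nlinarith [norm_nonneg h]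

/-- Test with the negative part `s` of `u`: `⟪u, s⟫ = -‖s‖²`. Nonnegativity thus becomes a family of
linear inequalities, which survive weak limits. -/
theorem ae_nonneg_of_forall_inner_nonneg (u : Lp ℝ 2 μ)
    (hu : ∀ h : Lp ℝ 2 μ, (∀ᵐ x ∂μ, 0 ≤ h x) → 0 ≤ inner ℝ u h) : ∀ᵐ x ∂μ, 0 ≤ u x := by
  have hlip : LipschitzWith 1 fun r : ℝ => max (-r) 0 :=
    (LipschitzWith.id.neg).max_const 0
  let s : Lp ℝ 2 μ := hlip.compLp (by simp) u
  have hs : s =ᵐ[μ] fun x => max (-u x) 0 := hlip.coeFn_compLp _ u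
  have h0 := hu s (by filter_upwards [hs] with x hx; rw [hx]; exact le_max_right _ _)
  have h1 : inner ℝ u s = -‖s‖ ^ 2 := by
    rw [← real_inner_self_eq_norm_sq, inner_L2_eq, inner_L2_eq, ← integral_neg]
    refine integral_congr_ae ?_
    filter_upwards [hs] with x hx
    rw [hx]
    rcases le_total 0 (u x) with h | h
    · simp [h]
    · rw [max_eq_left (by linarith)]; ring
  have h2 : s = 0 := by
    rw [← norm_eq_zero]
    nlinarith [norm_nonneg s]
  filter_upwards [hs, (Lp.eq_zero_iff_ae_eq_zero.1 h2)] with x h3 h4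
  rw [h4, Pi.zero_apply] at h3
  linarith [le_max_left (-u x) 0]

/-- By Hölder, multiplication by an `L^∞` function is bounded on `L²`; this makes each term of
`bilin` continuous. -/
theorem exists_weighted_inner {c : α → ℝ} (hc : MemLp c ∞ μ) :
    ∃ T : Lp ℝ 2 μ →L[ℝ] Lp ℝ 2 μ, ∀ u v, ∫ x, c x * u x * v x ∂μ = inner ℝ (T u) v := by
  refine ⟨(ContinuousLinearMap.mul ℝ ℝ).holderL μ ∞ 2 2 (hc.toLp c), fun u v => ?_⟩
  rw [inner_L2_eq]
  refine integral_congr_ae ?_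
  filter_upwards [hc.coeFn_toLp,
    (ContinuousLinearMap.mul ℝ ℝ).coeFn_holder (r := 2) (hc.toLp c) u] with x h1 h2
  change _ = ((ContinuousLinearMap.mul ℝ ℝ).holder 2 (hc.toLp c) u) x * v x
  rw [h2, h1]
  simp

end L2

/-! ### The penalized and obstacle problems in an abstract Hilbert space. -/

section Abstract
variable {α V : Type*} [MeasurableSpace α] {μ : Measure α} [NormedAddCommGroup V]
  [InnerProductSpace ℝ V]

theorem isClosed_setOf_ae_nonneg (J : V →L[ℝ] Lp ℝ 2 μ) (φ : V) :
    IsClosed {v : V | ∀ᵐ x ∂μ, 0 ≤ J (v - φ) x} := by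
  have : {v : V | ∀ᵐ x ∂μ, 0 ≤ J (v - φ) x} =
      {v | ∀ h : Lp ℝ 2 μ, (∀ᵐ x ∂μ, 0 ≤ h x) → 0 ≤ inner ℝ (J (v - φ)) h} := by
    ext v
    refine ⟨fun hv h hh => ?_, fun hv => ae_nonneg_of_forall_inner_nonneg _ hv⟩
    rw [inner_L2_eq]
    refine integral_nonneg_of_ae ?_
    filter_upwards [hv, hh] with x h1 h2 using mul_nonneg h1 h2
  rw [this]
  simp only [Set.ofPred_forall]
  exact isClosed_iInter fun h => isClosed_iInter fun _ =>
    isClosed_le continuous_const (by fun_prop)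

/-- Test with `y - φ`: the penalty term is nonnegative, so the coercive quadratic term is dominated
by terms at most linear in `‖y‖`. The point is that `R'` and `C` do not depend on `δ`. -/
theorem penalty_energy_bound {B : V →L[ℝ] V →L[ℝ] ℝ} {m : ℝ} (hm : 0 < m)
    (hB : ∀ u, m * ‖u‖ ^ 2 ≤ B u u) (J : V →L[ℝ] Lp ℝ 2 μ) (f : Lp ℝ 2 μ) (R : ℝ) :
    ∃ R' C : ℝ, ∀ (δ : ℝ) (hδ : 0 < δ) (φ y : V), ‖φ‖ ≤ R →
      (∀ v, B y v + inner ℝ (penaltyL2 hδ (J (y - φ))) (J v) = inner ℝ f (J v)) →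
      ‖y‖ ≤ R' ∧ inner ℝ (penaltyL2 hδ (J (y - φ))) (J (y - φ)) ≤ C := by
  set β := ‖B‖
  set γ := ‖f‖ * ‖J‖
  -- The lower bound `1` lets the constant term `γ * R` be absorbed into `γ * R * ‖y‖`.
  set R' := max 1 ((β * R + γ + γ * R) / m)
  refine ⟨R', γ * (R' + R) + β * R' * (R' + R), fun δ hδ φ y hφ hy => ?_⟩
  have hR : 0 ≤ R := (norm_nonneg _).trans hφ
  have hβ : 0 ≤ β := norm_nonneg B
  have hγ : 0 ≤ γ := by positivity
  have hBb : ∀ u v, |B u v| ≤ β * ‖u‖ * ‖v‖ := fun u v => B.le_opNorm₂ u v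
  have hf : ∀ v, |inner ℝ f (J v)| ≤ γ * ‖v‖ := fun v =>
    (abs_real_inner_le_norm _ _).trans (by
      rw [mul_assoc]; exact mul_le_mul_of_nonneg_left (J.le_opNorm v) (norm_nonneg _))
  have hsub : ‖y - φ‖ ≤ ‖y‖ + R := (norm_sub_le _ _).trans (by gcongr)
  have h1 := hy (y - φ)
  have hE : 0 ≤ inner ℝ (penaltyL2 hδ (J (y - φ))) (J (y - φ)) := by
    have := inner_penaltyL2_nonpos hδ (J (y - φ)) 0
      (by filter_upwards [Lp.coeFn_zero ℝ 2 μ] with x hx; rw [hx]; rfl)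
    rw [zero_sub, inner_neg_right] at this
    linarith
  have hf' : |inner ℝ f (J (y - φ))| ≤ γ * (‖y‖ + R) :=
    (hf _).trans (mul_le_mul_of_nonneg_left hsub hγ)
  have hY : ‖y‖ ≤ R' := by
    by_contra! hlt
    have hY1 : 1 < ‖y‖ := (le_max_left _ _).trans_lt hlt
    have hY2 : β * R + γ + γ * R < ‖y‖ * m :=
      (div_lt_iff₀ hm).1 ((le_max_right _ _).trans_lt hlt)
    have h2 : B y φ ≤ β * ‖y‖ * R :=
      (le_abs_self _).trans ((hBb y φ).trans (by gcongr))
    have h3 := hB y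
    have h4 := (le_abs_self _).trans hf'
    rw [map_sub (B y)] at h1
    have h5 : γ * R ≤ γ * R * ‖y‖ := le_mul_of_one_le_right (by positivity) hY1.le
    have h6 : (β * R + γ + γ * R) * ‖y‖ < ‖y‖ * m * ‖y‖ := by gcongr
    nlinarith
  refine ⟨hY, ?_⟩
  have h2 : -B y (y - φ) ≤ β * R' * (R' + R) :=
    (neg_le_abs _).trans ((hBb _ _).trans (by gcongr; exact hsub.trans (by gcongr)))
  have h3 : inner ℝ f (J (y - φ)) ≤ γ * (R' + R) :=
    (le_abs_self _).trans (hf'.trans (by gcongr))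
  linarith

variable [CompleteSpace V]

open ContinuousLinearMap in
theorem existsUnique_penalized (B : V →L[ℝ] V →L[ℝ] ℝ) {m : ℝ} (hm : 0 < m)
    (hB : ∀ u, m * ‖u‖ ^ 2 ≤ B u u) (J : V →L[ℝ] Lp ℝ 2 μ) (f : Lp ℝ 2 μ) {δ : ℝ} (hδ : 0 < δ)
    (ψ : V) :
    ∃! y, ∀ v, B y v + inner ℝ (penaltyL2 hδ (J (y - ψ))) (J v) = inner ℝ f (J v) := by
  let S := InnerProductSpace.continuousLinearMapOfBilin (𝕜 := ℝ) B
  have hS : ∀ u v, inner ℝ (S u) v = B u v :=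
    InnerProductSpace.continuousLinearMapOfBilin_apply B
  let G : V → V := fun y => S y + adjoint J (penaltyL2 hδ (J (y - ψ))) - adjoint J f
  have hGv : ∀ y v, inner ℝ (G y) v =
      B y v + inner ℝ (penaltyL2 hδ (J (y - ψ))) (J v) - inner ℝ f (J v) := fun y v => by
    simp only [G, inner_sub_left, inner_add_left, hS, adjoint_inner_left]
  have hGL := (S.lipschitz.add ((adjoint J).lipschitz.comp ((lipschitz_penaltyL2 hδ).comp
    (J.lipschitz.comp (LipschitzWith.id.sub (LipschitzWith.const ψ)))))).sub
    (LipschitzWith.const (adjoint J f))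
  have hmono : ∀ u v, m * ‖u - v‖ ^ 2 ≤ inner ℝ (G u - G v) (u - v) := fun u v => by
    have h1 := hB (u - v)
    have h2 := inner_penaltyL2_sub_nonneg hδ (J (u - ψ)) (J (v - ψ))
    have h3 : J (u - ψ) - J (v - ψ) = J (u - v) := by rw [← map_sub, sub_sub_sub_cancel_right]
    rw [h3, inner_sub_left] at h2
    rw [map_sub B, sub_apply] at h1
    rw [inner_sub_left, hGv, hGv]
    linarith
  have key : ∀ y, (y ∈ Set.univ ∧ ∀ v ∈ Set.univ, 0 ≤ inner ℝ (G y) (v - y)) ↔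
      ∀ v, B y v + inner ℝ (penaltyL2 hδ (J (y - ψ))) (J v) = inner ℝ f (J v) := fun y => by
    constructor
    · rintro ⟨-, h⟩ v
      -- On the whole space, the test directions `v` and `-v` turn the inequality into an equation.
      have h1 := h (v + y) trivial
      have h2 := h (-v + y) trivial
      rw [add_sub_cancel_right] at h1 h2
      rw [inner_neg_right] at h2
      rw [hGv] at h1 h2
      linarith
    · refine fun h => ⟨trivial, fun v _ => ?_⟩
      rw [hGv, h, sub_self]
  have := existsUnique_variationalInequality hm hGL hmono Set.univ_nonempty isClosed_univ
    convex_univ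
  exact (existsUnique_congr key).1 this

open ContinuousLinearMap in
theorem existsUnique_obstacle (B : V →L[ℝ] V →L[ℝ] ℝ) {m : ℝ} (hm : 0 < m)
    (hB : ∀ u, m * ‖u‖ ^ 2 ≤ B u u) (F : V →L[ℝ] ℝ) {K : Set V} (hne : K.Nonempty)
    (hcl : IsClosed K) (hK : Convex ℝ K) :
    ∃! y, y ∈ K ∧ ∀ v ∈ K, F (v - y) ≤ B y (v - y) := by
  let S := InnerProductSpace.continuousLinearMapOfBilin (𝕜 := ℝ) B
  have hS : ∀ u v, inner ℝ (S u) v = B u v :=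
    InnerProductSpace.continuousLinearMapOfBilin_apply B
  let b := (InnerProductSpace.toDual ℝ V).symm F
  have hb : ∀ v, inner ℝ b v = F v := fun v => InnerProductSpace.toDual_symm_apply
  have h := existsUnique_variationalInequality (G := fun y => S y - b) hm
    (S.lipschitz.sub (LipschitzWith.const b)) (fun u v => by
      rw [sub_sub_sub_cancel_right, ← map_sub, hS]
      exact hB _) hne hcl hK
  simpa only [inner_sub_left, hS, hb, sub_nonneg] using h

open ContinuousLinearMap in
theorem tendsto_penalized [IsFiniteMeasure μ] {B : V →L[ℝ] V →L[ℝ] ℝ} {m : ℝ} (hm : 0 < m)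
    (hB : ∀ u, m * ‖u‖ ^ 2 ≤ B u u) (J : V →L[ℝ] Lp ℝ 2 μ) (f : Lp ℝ 2 μ) {φδ yδ : ℝ → V}
    {φ y : V} (hφ : Tendsto φδ (𝓝[>] 0) (𝓝 φ))
    (hyδ : ∀ (δ : ℝ) (hδ : 0 < δ) (v : V),
      B (yδ δ) v + inner ℝ (penaltyL2 hδ (J (yδ δ - φδ δ))) (J v) = inner ℝ f (J v))
    (hy : ∀ᵐ x ∂μ, 0 ≤ J (y - φ) x)
    (hyv : ∀ v, (∀ᵐ x ∂μ, 0 ≤ J (v - φ) x) → inner ℝ f (J (v - y)) ≤ B y (v - y)) :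
    Tendsto yδ (𝓝[>] 0) (𝓝 y) := by
  rw [tendsto_iff_ultrafilter]
  intro U hU
  obtain ⟨R', C, hRC⟩ := penalty_energy_bound hm hB J f (‖φ‖ + 1)
  have hφU : Tendsto φδ U (𝓝 φ) := hφ.mono_left hU
  have hpos : ∀ᶠ δ : ℝ in (U : Filter ℝ), 0 < δ := hU self_mem_nhdsWithin
  have hbd : ∀ᶠ δ in (U : Filter ℝ), ‖φδ δ‖ ≤ ‖φ‖ + 1 :=
    hφU.norm.eventually_le_const (lt_add_one _)
  have hyR : ∀ᶠ δ in (U : Filter ℝ), ‖yδ δ‖ ≤ R' := by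
    filter_upwards [hpos, hbd] with δ hδ h using (hRC δ hδ _ _ h (hyδ δ hδ)).1
  obtain ⟨z, hz⟩ := U.exists_tendsto_inner hyR
  have hsqrt : Tendsto (fun δ : ℝ => √δ) U (𝓝 0) := by
    have := (Real.continuous_sqrt.tendsto 0).mono_left (nhdsWithin_le_nhds (s := Set.Ioi 0))
    rw [Real.sqrt_zero] at this
    exact this.mono_left hU
  have hzφ : ∀ᵐ x ∂μ, 0 ≤ J (z - φ) x := by
    refine ae_nonneg_of_forall_inner_nonneg _ fun h hh => ?_
    -- The choice `ε = √δ` sends both `ε²` and `δ * C / ε = √δ * C` to zero.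
    have hlim : Tendsto (fun δ : ℝ => inner ℝ (yδ δ) (adjoint J h) - inner ℝ (φδ δ) (adjoint J h) +
        √(√δ ^ 2 * μ.real Set.univ + √δ * C) * ‖h‖) U
        (𝓝 (inner ℝ z (adjoint J h) - inner ℝ φ (adjoint J h) +
          √((0 : ℝ) ^ 2 * μ.real Set.univ + 0 * C) * ‖h‖)) :=
      ((hz _).sub (hφU.inner tendsto_const_nhds)).add
        ((((hsqrt.pow 2).mul_const _).add (hsqrt.mul_const C)).sqrt.mul_const _)
    have h0 := ge_of_tendsto hlim (b := 0) (by
      filter_upwards [hpos, hbd, hsqrt.eventually_le_const (show (0 : ℝ) < 1 / 2 by norm_num)]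
        with δ hδ hb hδ'
      have := inner_add_penalty_nonneg hδ (Real.sqrt_pos.2 hδ) hδ' (J (yδ δ - φδ δ)) h hh
        (hRC δ hδ _ _ hb (hyδ δ hδ)).2
      rw [← adjoint_inner_right, inner_sub_left, mul_div_right_comm, Real.div_sqrt] at this
      exact this)
    rw [← adjoint_inner_right, inner_sub_left]
    simpa using h0
  let S := InnerProductSpace.continuousLinearMapOfBilin (𝕜 := ℝ) B
  have hS : ∀ u v, inner ℝ v (S u) = B u v := fun u v => by
    rw [real_inner_comm]; exact InnerProductSpace.continuousLinearMapOfBilin_apply B u v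
  have hJ : ∀ v, inner ℝ v (adjoint J f) = inner ℝ f (J v) := fun v => by
    rw [adjoint_inner_right, real_inner_comm]
  set D := ‖f‖ * ‖J‖ + ‖B‖ * R'
  -- The quotient is only known to have a nonpositive limit; the maximum with `0` makes the bound
  -- tend to `0` exactly.
  have hest : ∀ᶠ δ in (U : Filter ℝ), ‖yδ δ - y‖ ^ 2 ≤
      max ((inner ℝ f (J (yδ δ - y)) - B y (yδ δ - y) + D * ‖φδ δ - φ‖) / m) 0 := by
    filter_upwards [hpos, hyR] with δ hδ hR
    refine le_max_of_le_left ((le_div_iff₀ hm).2 ?_)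
    have h1 := hB (yδ δ - y)
    -- Shifting `y` by `φδ δ - φ` makes it admissible for the obstacle `φδ δ`, so `h3` can discard
    -- the penalty term.
    have h2 := hyδ δ hδ (y + (φδ δ - φ) - yδ δ)
    have h3 := inner_penaltyL2_nonpos hδ (J (yδ δ - φδ δ)) _ hy
    have h4 : J (y - φ) - J (yδ δ - φδ δ) = J (y + (φδ δ - φ) - yδ δ) := by
      rw [← map_sub]; congr 1; abel
    rw [h4] at h3
    have h5 : B (yδ δ) (φδ δ - φ) ≤ ‖B‖ * R' * ‖φδ δ - φ‖ :=
      (le_abs_self _).trans ((B.le_opNorm₂ _ _).trans (by gcongr))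
    have h6 : -inner ℝ f (J (φδ δ - φ)) ≤ ‖f‖ * ‖J‖ * ‖φδ δ - φ‖ :=
      (neg_le_abs _).trans ((abs_real_inner_le_norm _ _).trans (by
        rw [mul_assoc]; gcongr; exact J.le_opNorm _))
    simp only [map_sub, map_add, sub_apply, inner_sub_right, inner_add_right]
      at h1 h2 h3 h5 h6 ⊢
    simp only [D, add_mul]
    linarith
  have hlim : Tendsto (fun δ =>
      max ((inner ℝ f (J (yδ δ - y)) - B y (yδ δ - y) + D * ‖φδ δ - φ‖) / m) 0) U (𝓝 0) := by
    have h1 : Tendsto (fun δ => (inner ℝ f (J (yδ δ - y)) - B y (yδ δ - y) +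
        D * ‖φδ δ - φ‖) / m) U
        (𝓝 ((inner ℝ f (J (z - y)) - B y (z - y) + D * ‖φ - φ‖) / m)) := by
      refine Tendsto.div_const (Tendsto.add (Tendsto.sub ?_ ?_)
        ((hφU.sub_const φ).norm.const_mul D)) m
      · simp only [← hJ, inner_sub_left]
        exact (hz _).sub_const _
      · simp only [← hS, inner_sub_left]
        exact (hz _).sub_const _
    have h2 : (inner ℝ f (J (z - y)) - B y (z - y) + D * ‖φ - φ‖) / m ≤ 0 := by
      rw [sub_self, norm_zero, mul_zero, add_zero]
      exact div_nonpos_of_nonpos_of_nonneg (sub_nonpos.2 (hyv z hzφ)) hm.le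
    have h3 := h1.max (tendsto_const_nhds (x := (0 : ℝ)))
    rwa [max_eq_right h2] at h3
  have hsq : Tendsto (fun δ => ‖yδ δ - y‖ ^ 2) U (𝓝 0) :=
    squeeze_zero' (.of_forall fun _ => sq_nonneg _) hest hlim
  rw [tendsto_iff_norm_sub_tendsto_zero]
  simpa using hsq.sqrt

end Abstract

/-! ### Translation of the concrete problem on `H¹₀(Ω)` into the abstract setting. -/

variable {n : ℕ} {Ω : Set (EuclideanSpace ℝ (Fin n))}

instance : CompleteSpace (H10 Ω) :=
  inferInstanceAs (CompleteSpace (testSubspace Ω).topologicalClosure)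

/-- The embedding `H¹₀(Ω) → L²(Ω)`. -/
def valL (Ω : Set (EuclideanSpace ℝ (Fin n))) : H10 Ω →L[ℝ] Lp ℝ 2 (vol Ω) :=
  (WithLp.fstL 2 ℝ _ _).comp (H10 Ω).subtypeL

/-- The weak gradient as a bounded operator. -/
def gradL (Ω : Set (EuclideanSpace ℝ (Fin n))) :
    H10 Ω →L[ℝ] Lp (EuclideanSpace ℝ (Fin n)) 2 (vol Ω) :=
  (WithLp.sndL 2 ℝ _ _).comp (H10 Ω).subtypeL

/-- The `i`-th weak partial derivative as a bounded operator. -/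
def weakPartialL (Ω : Set (EuclideanSpace ℝ (Fin n))) (i : Fin n) :
    H10 Ω →L[ℝ] Lp ℝ 2 (vol Ω) :=
  ((EuclideanSpace.proj (𝕜 := ℝ) i).compLpL 2 (vol Ω)).comp (gradL Ω)

theorem valL_apply (u : H10 Ω) : valL Ω u = val u := rfl

theorem coeFn_weakPartialL (i : Fin n) (u : H10 Ω) :
    weakPartialL Ω i u =ᵐ[vol Ω] fun x => grad u x i :=
  (EuclideanSpace.proj (𝕜 := ℝ) i).coeFn_compLpL (grad u)

theorem exists_bilin_eq (A : Coefficients Ω) :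
    ∃ B : H10 Ω →L[ℝ] H10 Ω →L[ℝ] ℝ, ∀ u v, bilin A u v = B u v := by
  choose T2 hT2 using fun i j => exists_weighted_inner (A.second_memLp i j)
  choose T1 hT1 using fun i => exists_weighted_inner (A.first_memLp i)
  obtain ⟨T0, hT0⟩ := exists_weighted_inner A.zeroth_memLp
  let I : Lp ℝ 2 (vol Ω) →L[ℝ] Lp ℝ 2 (vol Ω) →L[ℝ] ℝ := innerSL ℝ
  have hI : ∀ p q, I p q = inner ℝ p q := fun _ _ => rfl
  refine ⟨(∑ i, ∑ j, I.bilinearComp ((T2 i j).comp (weakPartialL Ω i)) (weakPartialL Ω j)) +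
    (∑ i, I.bilinearComp ((T1 i).comp (weakPartialL Ω i)) (valL Ω)) +
    I.bilinearComp (T0.comp (valL Ω)) (valL Ω), fun u v => ?_⟩
  simp only [add_apply, sum_apply,
    ContinuousLinearMap.bilinearComp_apply, ContinuousLinearMap.comp_apply, hI,
    ← hT2, ← hT1, ← hT0, valL_apply, bilin]
  congr 2
  · refine Finset.sum_congr rfl fun i _ => Finset.sum_congr rfl fun j _ => integral_congr_ae ?_
    filter_upwards [coeFn_weakPartialL i u, coeFn_weakPartialL j v] with x h1 h2
    rw [h1, h2]
  · refine Finset.sum_congr rfl fun i _ => integral_congr_ae ?_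
    filter_upwards [coeFn_weakPartialL i u] with x h1
    rw [h1]

theorem isPenalizedSolution_iff {A : Coefficients Ω} {B : H10 Ω →L[ℝ] H10 Ω →L[ℝ] ℝ}
    (hB : ∀ u v, bilin A u v = B u v) (f : Lp ℝ 2 (vol Ω)) {δ : ℝ} (hδ : 0 < δ) (φ y : H10 Ω) :
    IsPenalizedSolution A f δ φ y ↔
      ∀ v, B y v + inner ℝ (penaltyL2 hδ (valL Ω (y - φ))) (valL Ω v) =
        inner ℝ f (valL Ω v) := by
  refine forall_congr' fun v => ?_
  rw [hB, inner_L2_eq, inner_L2_eq, valL_apply v]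
  have : ∫ x in Ω, penalty δ (val y x - val φ x) * val v x =
      ∫ x in Ω, penaltyL2 hδ (valL Ω (y - φ)) x * val v x := by
    refine integral_congr_ae ?_
    filter_upwards [coeFn_penaltyL2 hδ (valL Ω (y - φ)), Lp.coeFn_sub (val y) (val φ)] with x h1 h2
    rw [h1]
    -- `val` commutes with subtraction definitionally.
    change _ = penalty δ ((val y - val φ) x) * _
    rw [h2, Pi.sub_apply]
  rw [this]

theorem mem_admissible_iff (φ y : H10 Ω) :
    y ∈ admissible φ ↔ ∀ᵐ x ∂(vol Ω), 0 ≤ valL Ω (y - φ) x := by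
  have h : valL Ω (y - φ) =ᵐ[vol Ω] fun x => val y x - val φ x := Lp.coeFn_sub (val y) (val φ)
  change (∀ᵐ x ∂(vol Ω), val φ x ≤ val y x) ↔ _
  refine eventually_congr ?_
  filter_upwards [h] with x hx
  rw [hx, sub_nonneg]

theorem convex_admissible (φ : H10 Ω) : Convex ℝ (admissible φ) := by
  intro u hu v hv a b ha hb hab
  have h : val (a • u + b • v) =ᵐ[vol Ω] fun x => a * val u x + b * val v x := by
    filter_upwards [Lp.coeFn_add (a • val u) (b • val v), Lp.coeFn_smul a (val u),
      Lp.coeFn_smul b (val v)] with x h1 h2 h3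
    change (a • val u + b • val v) x = _
    rw [h1, Pi.add_apply, h2, h3]
    rfl
  change ∀ᵐ x ∂(vol Ω), _
  filter_upwards [h, hu, hv] with x hx h1 h2
  rw [hx]
  calc val φ x = a * val φ x + b * val φ x := by rw [← add_mul, hab, one_mul]
    _ ≤ _ := by gcongr

theorem isClosed_admissible (φ : H10 Ω) : IsClosed (admissible φ) := by
  have : admissible φ = {y | ∀ᵐ x ∂(vol Ω), 0 ≤ valL Ω (y - φ) x} :=
    Set.ext fun y => mem_admissible_iff φ y
  exact this ▸ isClosed_setOf_ae_nonneg (valL Ω) φ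

theorem isObstacleSolution_iff {A : Coefficients Ω} {B : H10 Ω →L[ℝ] H10 Ω →L[ℝ] ℝ}
    (hB : ∀ u v, bilin A u v = B u v) (f : Lp ℝ 2 (vol Ω)) (φ y : H10 Ω) :
    IsObstacleSolution A f φ y ↔ y ∈ admissible φ ∧
      ∀ v ∈ admissible φ, ((innerSL ℝ f).comp (valL Ω)) (v - y) ≤ B y (v - y) := by
  simp only [IsObstacleSolution, hB, ContinuousLinearMap.comp_apply, innerSL_apply_apply,
    inner_L2_eq, valL_apply]

end ObstacleProblem
end

/-! ### The main theorem. -/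

theorem mainTheorem4 {n : ℕ} (Ω : Set (EuclideanSpace ℝ (Fin n)))
    (hΩ_open : IsOpen Ω) (hΩ_bdd : Bornology.IsBounded Ω)
    (A : ObstacleProblem.Coefficients Ω) (hA : ObstacleProblem.IsCoerciveForm A)
    (f : Lp ℝ 2 (ObstacleProblem.vol Ω)) :
    (∀ δ : ℝ, 0 < δ → ∀ ψ : ObstacleProblem.H10 Ω,
      ∃! y, ObstacleProblem.IsPenalizedSolution A f δ ψ y) ∧
    (∀ ψ : ObstacleProblem.H10 Ω, ∃! y, ObstacleProblem.IsObstacleSolution A f ψ y) ∧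
    ∀ (φδ : ℝ → ObstacleProblem.H10 Ω) (φ : ObstacleProblem.H10 Ω),
      Tendsto φδ (𝓝[>] 0) (𝓝 φ) →
      Tendsto (fun δ => ObstacleProblem.penalizedState A f δ (φδ δ)) (𝓝[>] 0)
        (𝓝 (ObstacleProblem.obstacleState A f φ)) := by
  open ObstacleProblem in
  obtain ⟨B, hB⟩ := exists_bilin_eq A
  obtain ⟨m, hm, hcoer⟩ := hA
  simp only [hB] at hcoer
  have hpen : ∀ δ : ℝ, 0 < δ → ∀ ψ : H10 Ω, ∃! y, IsPenalizedSolution A f δ ψ y :=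
    fun δ hδ ψ => (existsUnique_congr fun y => isPenalizedSolution_iff hB f hδ ψ y).2
      (existsUnique_penalized B hm hcoer (valL Ω) f hδ ψ)
  have hobs : ∀ ψ : H10 Ω, ∃! y, IsObstacleSolution A f ψ y :=
    fun ψ => (existsUnique_congr fun y => isObstacleSolution_iff hB f ψ y).2
      (existsUnique_obstacle B hm hcoer _ ⟨ψ, ae_of_all (vol Ω) fun x => le_refl (val ψ x)⟩
        (isClosed_admissible ψ) (convex_admissible ψ))
  refine ⟨hpen, hobs, fun φδ φ hφ => ?_⟩
  -- Finiteness of `|Ω|` lets the term `ε²|Ω|` in the negative-part estimate vanish.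
  have : IsFiniteMeasure (vol Ω) := ⟨by
    rw [Measure.restrict_apply_univ]; exact hΩ_bdd.measure_lt_top⟩
  have hsol : IsObstacleSolution A f φ (obstacleState A f φ) :=
    Classical.epsilon_spec (hobs φ).exists
  rw [isObstacleSolution_iff hB] at hsol
  refine tendsto_penalized hm hcoer (valL Ω) f hφ (fun δ hδ => ?_)
    ((mem_admissible_iff _ _).1 hsol.1) fun v hv => hsol.2 v ((mem_admissible_iff _ _).2 hv)
  exact (isPenalizedSolution_iff hB f hδ _ _).1
    (Classical.epsilon_spec (hpen δ hδ (φδ δ)).exists)
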